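/- For probability measures $\mu,\nu$ on a measurable space and $0<q\le\infty$, let $\mathsf R_q(\mu\,\|\,\nu)\in[0,\infty]$ denote the Rényi divergence of order $q$: if $\mu\ll\nu$, then $$\mathsf R_q(\mu\,\|\,\nu)=\frac1{q-1}\log\int\Bigl(\frac{d\mu}{d\nu}\Bigr)^q d\nu\quad(q\neq1,\infty),\qquad \mathsf R_1(\mu\,\|\,\nu)=\mathsf{KL}(\mu\,\|\,\nu)=\int\frac{d\mu}{d\nu}\log\frac{d\mu}{d\nu}\,d\nu,\qquad \mathsf R_\infty(\mu\,\|\,\nu)=\log\Bigl\|\frac{d\mu}{d\nu}\Bigr\|_{L^\infty(\nu)};$$ if $\mu\not\ll\nu$, then $\mathsf R_q(\mu\,\|\,\nu)=+\infty$ for $q\ge1$, and $\mathsf R_q(\mu\,\|\,\nu)=\frac1{q-1}\log\int(\frac{d\mu}{d\lambda})^q(\frac{d\nu}{d\lambda})^{1-q}\,d\lambda$ with $\lambda=\mu+\nu$ for $q<1$ (where $\log 0=-\infty$). Let $W_\infty(\mu,\nu)=\inf_\gamma \operatorname{ess\,sup}_{(x,y)\sim\gamma}\|x-y\|\in[0,\infty]$,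 the infimum running over all couplings $\gamma$ of $\mu$ and $\nu$. Theorem. Let $0<q\le\infty$, and let $P$ be a Markov kernel on $\mathbb R^d$ such that the following two conditions hold. (a) There is $c>0$ such that $\mathsf R_q(\delta_xP\,\|\,\delta_yP)\le c\,\|x-y\|^2$ for all $x,y\in\mathbb R^d$. If $q<1$, assume moreover that there is $c'<\infty$ such that $\mathsf R_1(\delta_xP\,\|\,\delta_yP)\le c'\,\|x-y\|^2$ for all $x,y\in\mathbb R^d$. (b) There is $L>0$ such that $W_\infty(\mu P,\nu P)\le L\,W_\infty(\mu,\nu)$ for all Borel probability measures $\mu,\nu$ on $\mathbb R^d$. Then, for every integer $N\ge1$ and all $x,y\in\mathbb R^d$, $$\mathsf R_q(\delta_xP^N\,\|\,\delta_yP^N)\le c\,\frac{L^{-2}-1}{L^{-2N}-1}\,\|x-y\|^2,$$ where for $L=1$ the fraction is read as its limiting value $1/N$. -/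

import Mathlib

open MeasureTheory ProbabilityTheory
open scoped ENNReal

noncomputable section

/-- The Rényi divergence `R_q(μ ‖ ν)` of order `q ∈ (0, ∞]` between probability measures,
with values in the extended reals. For `q = 1` it is the Kullback-Leibler divergence, for `q = ∞`
the logarithm of the `ν`-essential supremum of `dμ/dν`. If `μ` is not absolutely continuous with
respect to `ν`, it is `+∞` for `q ≥ 1`, and for `q < 1` it is computed with the densities
with respect to the dominating measure `μ + ν`. (In the case `q < 1`, an integral equal to `0`
gives the value `(q - 1)⁻¹ * (-∞) = +∞`.) -/
def renyiDiv {α : Type*} [MeasurableSpace α] (q : ℝ≥0∞) (μ ν : Measure α) : EReal :=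
  open Classical in
  if q = 1 then (InformationTheory.klDiv μ ν : EReal)
  else if μ ≪ ν then
    if q = ∞ then ENNReal.log (essSup (μ.rnDeriv ν) ν)
    else (((q.toReal - 1)⁻¹ : ℝ) : EReal) *
      ENNReal.log (∫⁻ x, μ.rnDeriv ν x ^ q.toReal ∂ν)
  else if q < 1 then (((q.toReal - 1)⁻¹ : ℝ) : EReal) *
      ENNReal.log (∫⁻ x, μ.rnDeriv (μ + ν) x ^ q.toReal *
        ν.rnDeriv (μ + ν) x ^ (1 - q.toReal) ∂(μ + ν))
  else ⊤

/-- The set of couplings of `μ` and `ν`: the measures on the product with marginals `μ`, `ν`. -/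
def couplings {α : Type*} [MeasurableSpace α] (μ ν : Measure α) : Set (Measure (α × α)) :=
  {γ | γ.fst = μ ∧ γ.snd = ν}

/-- The `∞`-Wasserstein distance: the infimum over couplings of the essential supremum of the
distance. It may be `+∞`. -/
def wassersteinInfty {α : Type*} [MeasurableSpace α] [PseudoEMetricSpace α]
    (μ ν : Measure α) : ℝ≥0∞ :=
  ⨅ γ ∈ couplings μ ν, essSup (fun p : α × α => edist p.1 p.2) γ

/-- The factor `(L⁻² - 1) / (L^(-2N) - 1)`, read as its limit `1 / N` at `L = 1`. -/
def multiStepFactor (L : ℝ) (N : ℕ) : ℝ :=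
  open Classical in
  if L = 1 then 1 / (N : ℝ)
  else (L ^ (-2 : ℤ) - 1) / (L ^ (-2 * (N : ℤ)) - 1)

end

open InformationTheory

/-!
Follow the chain started at `μ' = δ_y` and move this proxy towards `δ_x` along a coupling, by a
fraction of the remaining distance before each step. The shifted composition rule charges `c` times
the squared displacement for a shift, after which the kernel contracts what is left of the distance
by `L` in `W_∞`. If `f` is the best constant for `n` steps, the best first fraction `t` minimizes
`t² + f L² (1 - t)²`, and iterating this optimum from `f = 1` gives the inverse of the geometric
sum `∑ k < N, L⁻²ᵏ`.

The composition rule is the chain rule for densities on a composition-product followed by data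
processing. For `q < 1` the Hellinger integral only involves the absolutely continuous parts, so
that both facts hold for measures that are not absolutely continuous, and for `q ≥ 1` a finite
divergence forces absolute continuity.
-/

/-- The Hellinger integral of order `r` of `μ` relative to `ν`, whose logarithm is `r - 1` times
the Rényi divergence of order `r`. It depends only on the part of `μ` that is absolutely continuous
with respect to `ν`, so for `1 ≤ r` it is the quantity of interest only when `μ ≪ ν`. -/
noncomputable def hellingerIntegral {α : Type*} [MeasurableSpace α] (r : ℝ) (μ ν : Measure α) :
    ℝ≥0∞ :=
  ∫⁻ x, μ.rnDeriv ν x ^ r ∂ν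

section Characterizations

variable {α : Type*} [MeasurableSpace α] {μ ν : Measure α} {q : ℝ≥0∞} {B : ℝ}

lemma renyiDiv_one (μ ν : Measure α) : renyiDiv 1 μ ν = (klDiv μ ν : EReal) := by
  simp [renyiDiv]

lemma renyiDiv_one_le_iff (hB : 0 ≤ B) :
    renyiDiv 1 μ ν ≤ (B : EReal) ↔ klDiv μ ν ≤ ENNReal.ofReal B := by
  rw [renyiDiv_one, ← EReal.coe_ennreal_le_coe_ennreal_iff, EReal.coe_ennreal_ofReal,
    max_eq_left hB]

lemma nonneg_of_renyiDiv_one_le (h : renyiDiv 1 μ ν ≤ (B : EReal)) : 0 ≤ B := by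
  rw [renyiDiv_one] at h
  exact_mod_cast (EReal.coe_ennreal_nonneg _).trans h

lemma log_le_coe_iff {x : ℝ≥0∞} : ENNReal.log x ≤ (B : EReal) ↔ x ≤ EReal.exp B := by
  rw [← ENNReal.log_le_log_iff, EReal.log_exp]

lemma absolutelyContinuous_of_renyiDiv_ne_top (hq : 1 ≤ q) (h : renyiDiv q μ ν ≠ ⊤) : μ ≪ ν := by
  contrapose! h
  by_cases h1 : q = 1
  · simp [h1, renyiDiv_one, klDiv_of_not_ac h]
  · simp [renyiDiv, h1, h, hq.not_gt]

lemma absolutelyContinuous_of_renyiDiv_le_coe (hq : 1 ≤ q) (h : renyiDiv q μ ν ≤ (B : EReal)) :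
    μ ≪ ν :=
  absolutelyContinuous_of_renyiDiv_ne_top hq (ne_top_of_le_ne_top (EReal.coe_ne_top B) h)

variable [IsFiniteMeasure μ] [IsFiniteMeasure ν]

lemma lintegral_rnDeriv_add_rpow_mul_rpow {r : ℝ} (hr0 : 0 ≤ r) (hr1 : r < 1) :
    ∫⁻ x, μ.rnDeriv (μ + ν) x ^ r * ν.rnDeriv (μ + ν) x ^ (1 - r) ∂(μ + ν) =
      hellingerIntegral r μ ν := by
  have hν : ν ≪ μ + ν := Measure.le_add_left le_rfl |>.absolutelyContinuous
  have hdens : hellingerIntegral r μ ν =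
      ∫⁻ x, (μ.rnDeriv (μ + ν) x / ν.rnDeriv (μ + ν) x) ^ r ∂ν :=
    lintegral_congr_ae ((Measure.rnDeriv_eq_div_rnDeriv_add μ ν).mono fun x hx ↦ by simp [hx])
  rw [hdens, ← lintegral_rnDeriv_mul hν (by fun_prop)]
  refine lintegral_congr_ae ?_
  filter_upwards [ν.rnDeriv_ne_top (μ + ν)] with x hx
  by_cases h0 : ν.rnDeriv (μ + ν) x = 0
  · simp [h0, hr1]
  · rw [ENNReal.div_rpow_of_nonneg _ _ hr0, ENNReal.rpow_sub _ _ h0 hx, ENNReal.rpow_one]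
    simp only [div_eq_mul_inv]
    ring

lemma renyiDiv_eq_mul_log_hellingerIntegral (hq1 : q ≠ 1) (hq : q ≠ ∞) (hac : 1 < q → μ ≪ ν) :
    renyiDiv q μ ν = ((q.toReal - 1)⁻¹ : ℝ) * ENNReal.log (hellingerIntegral q.toReal μ ν) := by
  by_cases h : μ ≪ ν
  · simp [renyiDiv, h, hq1, hq, hellingerIntegral]
  · have hlt : q < 1 := (not_lt.1 (mt hac h)).lt_of_ne hq1
    have hr : q.toReal < 1 := by simpa using ENNReal.toReal_strict_mono ENNReal.one_ne_top hlt
    simp [renyiDiv, h, hq1, hlt, lintegral_rnDeriv_add_rpow_mul_rpow ENNReal.toReal_nonneg hr]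

lemma renyiDiv_le_iff_rpow (hq1 : q ≠ 1) (hq : q ≠ ∞) (hac : 1 < q → μ ≪ ν) :
    renyiDiv q μ ν ≤ (B : EReal) ↔
      hellingerIntegral q.toReal μ ν ^ (q.toReal - 1)⁻¹ ≤ EReal.exp B := by
  rw [renyiDiv_eq_mul_log_hellingerIntegral hq1 hq hac, ← ENNReal.log_rpow, log_le_coe_iff]

lemma renyiDiv_le_iff_of_lt_one (hq : q < 1) :
    renyiDiv q μ ν ≤ (B : EReal) ↔
      EReal.exp B ^ (q.toReal - 1) ≤ hellingerIntegral q.toReal μ ν := by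
  have hr : q.toReal < 1 := by simpa using ENNReal.toReal_strict_mono ENNReal.one_ne_top hq
  rw [renyiDiv_le_iff_rpow hq.ne hq.ne_top fun h ↦ absurd h hq.not_gt, ← neg_sub 1 q.toReal,
    inv_neg, ENNReal.rpow_neg, ENNReal.rpow_neg, ENNReal.inv_le_iff_inv_le,
    ENNReal.le_rpow_inv_iff (sub_pos.2 hr), ENNReal.inv_rpow]

lemma renyiDiv_le_iff_of_one_lt (hq1 : 1 < q) (hq : q ≠ ∞) :
    renyiDiv q μ ν ≤ (B : EReal) ↔
      μ ≪ ν ∧ hellingerIntegral q.toReal μ ν ≤ EReal.exp B ^ (q.toReal - 1) := by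
  have hr : 1 < q.toReal := by simpa using ENNReal.toReal_strict_mono hq hq1
  rw [← and_iff_right_of_imp (absolutelyContinuous_of_renyiDiv_le_coe hq1.le)]
  refine and_congr_right fun hac ↦ ?_
  rw [renyiDiv_le_iff_rpow hq1.ne' hq fun _ ↦ hac, ENNReal.rpow_inv_le_iff (sub_pos.2 hr)]

lemma essSup_rnDeriv_le_iff (hac : μ ≪ ν) {M : ℝ≥0∞} :
    essSup (μ.rnDeriv ν) ν ≤ M ↔ μ ≤ M • ν := by
  constructor
  · intro hM
    rw [← Measure.withDensity_rnDeriv_eq μ ν hac, ← withDensity_const]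
    exact withDensity_mono ((ENNReal.ae_le_essSup _).mono fun x hx ↦ hx.trans hM)
  · intro hM
    refine essSup_le_of_ae_le _ ?_
    refine ae_le_of_forall_setLIntegral_le_of_sigmaFinite (by fun_prop) fun s _ _ ↦ ?_
    rw [setLIntegral_const]
    exact (Measure.setLIntegral_rnDeriv_le s).trans (by simpa using hM s)

lemma renyiDiv_top_le_iff : renyiDiv ∞ μ ν ≤ (B : EReal) ↔ μ ≤ EReal.exp B • ν := by
  have hac_of_le (h : μ ≤ EReal.exp B • ν) : μ ≪ ν :=
    Measure.absolutelyContinuous_of_le_smul h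
  rw [← and_iff_right_of_imp (absolutelyContinuous_of_renyiDiv_le_coe le_top),
    ← and_iff_right_of_imp hac_of_le]
  refine and_congr_right fun hac ↦ ?_
  rw [← essSup_rnDeriv_le_iff hac, ← log_le_coe_iff]
  simp [renyiDiv, hac]

lemma renyiDiv_self (q : ℝ≥0∞) (μ : Measure α) [IsProbabilityMeasure μ] : renyiDiv q μ μ = 0 := by
  by_cases h1 : q = 1
  · simp [h1, renyiDiv_one]
  by_cases htop : q = ∞
  · simp [renyiDiv, htop, essSup_congr_ae μ.rnDeriv_self, Measure.AbsolutelyContinuous.rfl]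
  · have hone : hellingerIntegral q.toReal μ μ = ∫⁻ _, 1 ∂μ :=
      lintegral_congr_ae (μ.rnDeriv_self.mono fun x hx ↦ by simp [hx])
    rw [renyiDiv_eq_mul_log_hellingerIntegral h1 htop fun _ ↦ .rfl, hone]
    simp

end Characterizations

section Pushforward

variable {α β : Type*} [MeasurableSpace α] [MeasurableSpace β] {μ ν : Measure α}
  {g : α → β} {r : ℝ}

lemma hellingerIntegral_eq_lintegral_ofReal (hr : 0 ≤ r) (μ ν : Measure α) [SigmaFinite μ] :
    hellingerIntegral r μ ν = ∫⁻ x, ENNReal.ofReal ((μ.rnDeriv ν x).toReal ^ r) ∂ν := by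
  refine lintegral_congr_ae ?_
  filter_upwards [μ.rnDeriv_ne_top ν] with x hx
  rw [ENNReal.toReal_rpow, ENNReal.ofReal_toReal (ENNReal.rpow_ne_top_of_nonneg hr hx)]

lemma hellingerIntegral_eq_ofReal_integral [SigmaFinite μ] (hr : 0 ≤ r)
    (h_int : Integrable (fun x ↦ (μ.rnDeriv ν x).toReal ^ r) ν) :
    hellingerIntegral r μ ν = ENNReal.ofReal (∫ x, (μ.rnDeriv ν x).toReal ^ r ∂ν) := by
  rw [hellingerIntegral_eq_lintegral_ofReal hr,
    ofReal_integral_eq_lintegral_ofReal h_int (ae_of_all _ fun x ↦ by positivity)]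

lemma hellingerIntegral_withDensity_rnDeriv (r : ℝ) (μ ν : Measure α) [SigmaFinite ν] :
    hellingerIntegral r (ν.withDensity (μ.rnDeriv ν)) ν = hellingerIntegral r μ ν :=
  lintegral_congr_ae
    ((Measure.rnDeriv_withDensity ν (μ.measurable_rnDeriv ν)).mono fun x hx ↦ by simp only [hx])

variable [IsFiniteMeasure μ] [IsFiniteMeasure ν]

lemma rnDeriv_mono_left {μ' : Measure α} [IsFiniteMeasure μ'] (h : μ' ≤ μ) :
    μ'.rnDeriv ν ≤ᵐ[ν] μ.rnDeriv ν := by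
  have hadd := Measure.rnDeriv_add' (μ - μ') μ' ν
  rw [Measure.sub_add_cancel_of_le h] at hadd
  filter_upwards [hadd] with x hx
  simp [hx]

lemma hellingerIntegral_mono_left {μ' : Measure α} [IsFiniteMeasure μ'] (hr : 0 ≤ r)
    (h : μ' ≤ μ) : hellingerIntegral r μ' ν ≤ hellingerIntegral r μ ν :=
  lintegral_mono_ae ((rnDeriv_mono_left h).mono fun _ hx ↦ ENNReal.rpow_le_rpow hx hr)

lemma integrable_rpow_rnDeriv_of_le_one (hr0 : 0 ≤ r) (hr1 : r ≤ 1) :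
    Integrable (fun x ↦ (μ.rnDeriv ν x).toReal ^ r) ν := by
  refine Integrable.mono' (g := fun x ↦ 1 + (μ.rnDeriv ν x).toReal)
    ((integrable_const _).add Measure.integrable_toReal_rnDeriv)
    (Measurable.aestronglyMeasurable (by fun_prop)) (ae_of_all _ fun x ↦ ?_)
  have h0 : 0 ≤ (μ.rnDeriv ν x).toReal := ENNReal.toReal_nonneg
  rw [Real.norm_of_nonneg (by positivity)]
  rcases le_total (μ.rnDeriv ν x).toReal 1 with h | h
  · exact (Real.rpow_le_one h0 h hr0).trans (by linarith)
  · exact (Real.rpow_le_self_of_one_le h hr1).trans (by linarith)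

lemma integral_convex_rnDeriv_map_le {f : ℝ → ℝ} (hac : μ ≪ ν) (hg : Measurable g)
    (hf_cvx : ConvexOn ℝ (Set.Ici 0) f) (hf_cont : Continuous f)
    (h_int : Integrable (fun x ↦ f (μ.rnDeriv ν x).toReal) ν) :
    ∫ x, f ((μ.map g).rnDeriv (ν.map g) x).toReal ∂(ν.map g) ≤
      ∫ x, f (μ.rnDeriv ν x).toReal ∂ν := by
  have hf := hf_cont.stronglyMeasurable
  have hf0 : ContinuousWithinAt f (Set.Ici 0) 0 := hf_cont.continuousWithinAt
  have h_int_map := hf_cvx.integrable_comp_rnDeriv_map hac hg hf hf0 h_int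
  rw [← integral_condExp hg.comap_le, integral_map hg.aemeasurable h_int_map.aestronglyMeasurable]
  exact integral_mono_ae (h_int_map.comp_measurable hg) integrable_condExp
    (hf_cvx.comp_rnDeriv_map_le hac hg hf hf0 h_int)

lemma hellingerIntegral_map_le (hac : μ ≪ ν) (hg : Measurable g) (hr : 1 ≤ r) :
    hellingerIntegral r (μ.map g) (ν.map g) ≤ hellingerIntegral r μ ν := by
  have hr0 : 0 ≤ r := zero_le_one.trans hr
  by_cases htop : hellingerIntegral r μ ν = ∞
  · simp [htop]
  have hcont : Continuous fun x : ℝ ↦ x ^ r := Real.continuous_rpow_const hr0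
  have h_int : Integrable (fun x ↦ (μ.rnDeriv ν x).toReal ^ r) ν := by
    rw [hellingerIntegral_eq_lintegral_ofReal hr0] at htop
    exact (lintegral_ofReal_ne_top_iff_integrable
      (Measurable.aestronglyMeasurable (by fun_prop)) (ae_of_all _ fun x ↦ by positivity)).1 htop
  have h_int_map := (convexOn_rpow hr).integrable_comp_rnDeriv_map hac hg
    hcont.stronglyMeasurable hcont.continuousWithinAt h_int
  rw [hellingerIntegral_eq_ofReal_integral hr0 h_int,
    hellingerIntegral_eq_ofReal_integral hr0 h_int_map]
  exact ENNReal.ofReal_le_ofReal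
    (integral_convex_rnDeriv_map_le hac hg (convexOn_rpow hr) hcont h_int)

lemma le_hellingerIntegral_map_of_ac (hac : μ ≪ ν) (hg : Measurable g) (hr0 : 0 ≤ r)
    (hr1 : r ≤ 1) : hellingerIntegral r μ ν ≤ hellingerIntegral r (μ.map g) (ν.map g) := by
  have hneg := integral_convex_rnDeriv_map_le hac hg (Real.concaveOn_rpow hr0 hr1).neg
    (Real.continuous_rpow_const hr0).neg (integrable_rpow_rnDeriv_of_le_one hr0 hr1).neg
  simp only [Pi.neg_apply, integral_neg, neg_le_neg_iff] at hneg
  rw [hellingerIntegral_eq_ofReal_integral hr0 (integrable_rpow_rnDeriv_of_le_one hr0 hr1),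
    hellingerIntegral_eq_ofReal_integral hr0 (integrable_rpow_rnDeriv_of_le_one hr0 hr1)]
  exact ENNReal.ofReal_le_ofReal hneg

lemma le_hellingerIntegral_map (hg : Measurable g) (hr0 : 0 ≤ r) (hr1 : r ≤ 1) :
    hellingerIntegral r μ ν ≤ hellingerIntegral r (μ.map g) (ν.map g) := by
  have hle : ν.withDensity (μ.rnDeriv ν) ≤ μ := Measure.withDensity_rnDeriv_le μ ν
  have := isFiniteMeasure_of_le μ hle
  calc hellingerIntegral r μ ν
      = hellingerIntegral r (ν.withDensity (μ.rnDeriv ν)) ν :=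
        (hellingerIntegral_withDensity_rnDeriv r μ ν).symm
    _ ≤ hellingerIntegral r ((ν.withDensity (μ.rnDeriv ν)).map g) (ν.map g) :=
        le_hellingerIntegral_map_of_ac (withDensity_absolutelyContinuous _ _) hg hr0 hr1
    _ ≤ hellingerIntegral r (μ.map g) (ν.map g) :=
        hellingerIntegral_mono_left hr0 (Measure.map_mono hle hg)

theorem renyiDiv_map_le (q : ℝ≥0∞) (hg : Measurable g) :
    renyiDiv q (μ.map g) (ν.map g) ≤ renyiDiv q μ ν := by
  refine EReal.le_of_forall_lt_iff_le.1 fun B hB ↦ ?_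
  replace hB := hB.le
  rcases lt_trichotomy q 1 with hq | rfl | hq
  · rw [renyiDiv_le_iff_of_lt_one hq] at hB ⊢
    refine hB.trans (le_hellingerIntegral_map hg ENNReal.toReal_nonneg ?_)
    simpa using ENNReal.toReal_mono ENNReal.one_ne_top hq.le
  · rw [renyiDiv_one] at hB ⊢
    exact (EReal.coe_ennreal_le_coe_ennreal_iff.2 (klDiv_map_le μ ν hg)).trans hB
  · rcases eq_or_ne q ∞ with rfl | htop
    · rw [renyiDiv_top_le_iff] at hB ⊢
      rw [← Measure.map_smul]
      exact Measure.map_mono hB hg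
    · rw [renyiDiv_le_iff_of_one_lt hq htop] at hB ⊢
      obtain ⟨hac, hB⟩ := hB
      refine ⟨hac.map hg, (hellingerIntegral_map_le hac hg ?_).trans hB⟩
      simpa using ENNReal.toReal_mono htop hq.le

end Pushforward

section CompProd

variable {α β : Type*} [MeasurableSpace α] [MeasurableSpace β]
  [MeasurableSpace.CountableOrCountablyGenerated α β]
  {μ ν : Measure α} [IsFiniteMeasure μ] [IsFiniteMeasure ν]
  {κ η : Kernel α β} [IsFiniteKernel κ] [IsFiniteKernel η] {r : ℝ} {C : ℝ≥0∞}

variable (μ ν κ η) in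
lemma rnDeriv_compProd_withDensity_rnDeriv_right :
    (μ ⊗ₘ η.withDensity (κ.rnDeriv η)).rnDeriv (ν ⊗ₘ η) =ᵐ[ν ⊗ₘ η] (μ ⊗ₘ κ).rnDeriv (ν ⊗ₘ η) := by
  have hsing : (μ ⊗ₘ κ.singularPart η).rnDeriv (ν ⊗ₘ η) =ᵐ[ν ⊗ₘ η] 0 :=
    (Measure.rnDeriv_eq_zero _ _).2 <| Measure.MutuallySingular.compProd_of_right μ ν <|
      ae_of_all _ fun a ↦ Kernel.mutuallySingular_singularPart κ η a
  have hadd := Measure.rnDeriv_add' (μ ⊗ₘ η.withDensity (κ.rnDeriv η)) (μ ⊗ₘ κ.singularPart η)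
    (ν ⊗ₘ η)
  rw [← Measure.compProd_add_right, Kernel.rnDeriv_add_singularPart] at hadd
  filter_upwards [hadd, hsing] with p hadd hsing
  simp [hadd, hsing]

variable (μ ν κ η) in
lemma rnDeriv_compProd_eq_mul :
    (μ ⊗ₘ κ).rnDeriv (ν ⊗ₘ η) =ᵐ[ν ⊗ₘ η]
      fun p ↦ μ.rnDeriv ν p.1 * κ.rnDeriv η p.1 p.2 := by
  have hmeas : Measurable fun p : α × β ↦ κ.rnDeriv η p.1 p.2 := by fun_prop
  have hfin : ∀ᵐ p ∂(μ ⊗ₘ η), κ.rnDeriv η p.1 p.2 ≠ ∞ :=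
    Measure.ae_compProd_of_ae_ae (hmeas (measurableSet_singleton ∞).compl)
      (ae_of_all _ fun _ ↦ κ.rnDeriv_ne_top η)
  have hdens := Measure.rnDeriv_withDensity_left (ν := ν ⊗ₘ η) hmeas.aemeasurable hfin
  rw [← Measure.compProd_withDensity (by fun_prop)] at hdens
  filter_upwards [rnDeriv_compProd_withDensity_rnDeriv_right μ ν κ η, hdens,
    rnDeriv_measure_compProd_left μ ν η] with p h1 h2 h3
  rw [← h1, h2, h3, mul_comm]

lemma hellingerIntegral_kernel (r : ℝ) (a : α) :
    hellingerIntegral r (κ a) (η a) = ∫⁻ b, κ.rnDeriv η a b ^ r ∂(η a) :=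
  lintegral_congr_ae (κ.rnDeriv_eq_rnDeriv_measure.mono fun x hx ↦ by simp only [hx])

lemma hellingerIntegral_compProd (hr : 0 ≤ r) :
    hellingerIntegral r (μ ⊗ₘ κ) (ν ⊗ₘ η) =
      ∫⁻ a, μ.rnDeriv ν a ^ r * hellingerIntegral r (κ a) (η a) ∂ν := by
  have hdens : hellingerIntegral r (μ ⊗ₘ κ) (ν ⊗ₘ η) =
      ∫⁻ p, μ.rnDeriv ν p.1 ^ r * κ.rnDeriv η p.1 p.2 ^ r ∂(ν ⊗ₘ η) :=
    lintegral_congr_ae ((rnDeriv_compProd_eq_mul μ ν κ η).mono fun p hp ↦ by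
      simp only [hp, ENNReal.mul_rpow_of_nonneg _ _ hr])
  rw [hdens, Measure.lintegral_compProd (by fun_prop)]
  refine lintegral_congr fun a ↦ ?_
  rw [hellingerIntegral_kernel]
  exact lintegral_const_mul (μ.rnDeriv ν a ^ r) (by fun_prop)

lemma mul_le_hellingerIntegral_compProd (hr : 0 < r)
    (hC : ∀ᵐ a ∂μ, C ≤ hellingerIntegral r (κ a) (η a)) :
    C * hellingerIntegral r μ ν ≤ hellingerIntegral r (μ ⊗ₘ κ) (ν ⊗ₘ η) := by
  rw [hellingerIntegral_compProd hr.le, hellingerIntegral, ← lintegral_const_mul _ (by fun_prop)]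
  refine lintegral_mono_ae ?_
  filter_upwards [Measure.ae_rnDeriv_ne_zero_imp_of_ae ν hC] with a ha
  by_cases h0 : μ.rnDeriv ν a = 0
  · simp [h0, hr]
  · rw [mul_comm]
    gcongr
    exact ha h0

lemma hellingerIntegral_compProd_le (hr : 0 < r)
    (hC : ∀ᵐ a ∂μ, hellingerIntegral r (κ a) (η a) ≤ C) :
    hellingerIntegral r (μ ⊗ₘ κ) (ν ⊗ₘ η) ≤ C * hellingerIntegral r μ ν := by
  rw [hellingerIntegral_compProd hr.le, hellingerIntegral, ← lintegral_const_mul _ (by fun_prop)]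
  refine lintegral_mono_ae ?_
  filter_upwards [Measure.ae_rnDeriv_ne_zero_imp_of_ae ν hC] with a ha
  by_cases h0 : μ.rnDeriv ν a = 0
  · simp [h0, hr]
  · rw [mul_comm]
    gcongr
    exact ha h0

lemma klDiv_compProd_right_eq_lintegral (hac : ∀ᵐ a ∂μ, κ a ≪ η a) :
    klDiv (μ ⊗ₘ κ) (μ ⊗ₘ η) = ∫⁻ a, klDiv (κ a) (η a) ∂μ := by
  have hdens : (μ ⊗ₘ κ).rnDeriv (μ ⊗ₘ η) =ᵐ[μ ⊗ₘ η] fun p ↦ κ.rnDeriv η p.1 p.2 := by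
    have hself : ∀ᵐ p ∂(μ ⊗ₘ η), μ.rnDeriv μ p.1 = 1 :=
      Measure.ae_eq_compProd_of_ae_eq_fst η (by fun_prop) (by fun_prop) μ.rnDeriv_self
    filter_upwards [rnDeriv_compProd_eq_mul μ μ κ η, hself] with p hp hself
    rw [hp, hself, one_mul]
  calc klDiv (μ ⊗ₘ κ) (μ ⊗ₘ η)
      = ∫⁻ p, ENNReal.ofReal (klFun (κ.rnDeriv η p.1 p.2).toReal) ∂(μ ⊗ₘ η) := by
        rw [klDiv_eq_lintegral_klFun_of_ac (.compProd_right hac)]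
        exact lintegral_congr_ae (hdens.mono fun p hp ↦ by simp only [hp])
    _ = ∫⁻ a, ∫⁻ b, ENNReal.ofReal (klFun (κ.rnDeriv η a b).toReal) ∂(η a) ∂μ :=
        Measure.lintegral_compProd (by fun_prop)
    _ = ∫⁻ a, klDiv (κ a) (η a) ∂μ := by
        refine lintegral_congr_ae (hac.mono fun a ha ↦
          .trans ?_ (klDiv_eq_lintegral_klFun_of_ac ha).symm)
        exact lintegral_congr_ae (κ.rnDeriv_eq_rnDeriv_measure.mono fun b hb ↦ by simp only [hb])

end CompProd

lemma compProd_le_smul_compProd {α β : Type*} [MeasurableSpace α] [MeasurableSpace β]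
    {μ ν : Measure α} [SFinite μ] [SFinite ν] {κ η : Kernel α β} [IsSFiniteKernel κ]
    [IsSFiniteKernel η] {C D : ℝ≥0∞} (hC : μ ≤ C • ν) (hD : ∀ᵐ a ∂μ, κ a ≤ D • η a) :
    μ ⊗ₘ κ ≤ (D * C) • (ν ⊗ₘ η) := by
  refine Measure.le_iff.2 fun s hs ↦ ?_
  rw [Measure.smul_apply, smul_eq_mul, Measure.compProd_apply hs, Measure.compProd_apply hs]
  calc ∫⁻ a, κ a (Prod.mk a ⁻¹' s) ∂μ
      ≤ ∫⁻ a, D * η a (Prod.mk a ⁻¹' s) ∂μ := lintegral_mono_ae (hD.mono fun a ha ↦ ha _)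
    _ = D * ∫⁻ a, η a (Prod.mk a ⁻¹' s) ∂μ :=
        lintegral_const_mul _ (Kernel.measurable_kernel_prodMk_left hs)
    _ ≤ D * ∫⁻ a, η a (Prod.mk a ⁻¹' s) ∂(C • ν) := by gcongr
    _ = D * C * ∫⁻ a, η a (Prod.mk a ⁻¹' s) ∂ν := by
        rw [lintegral_smul_measure, smul_eq_mul, mul_assoc]

lemma exp_coe_add_rpow (B C s : ℝ) :
    EReal.exp ((B + C : ℝ) : EReal) ^ s = EReal.exp C ^ s * EReal.exp B ^ s := by
  rw [EReal.coe_add, EReal.exp_add, ENNReal.mul_rpow_of_ne_top (by simp) (by simp), mul_comm]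

theorem renyiDiv_compProd_le {α β : Type*} [MeasurableSpace α] [MeasurableSpace β]
    [MeasurableSpace.CountableOrCountablyGenerated α β] {μ ν : Measure α} [IsProbabilityMeasure μ]
    [IsFiniteMeasure ν] {κ η : Kernel α β} [IsMarkovKernel κ] [IsMarkovKernel η] {q : ℝ≥0∞}
    (hq : 0 < q) {B C : ℝ}
    (hB : renyiDiv q μ ν ≤ (B : EReal)) (hC : ∀ᵐ a ∂μ, renyiDiv q (κ a) (η a) ≤ (C : EReal)) :
    renyiDiv q (μ ⊗ₘ κ) (ν ⊗ₘ η) ≤ ((B + C : ℝ) : EReal) := by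
  rcases lt_trichotomy q 1 with hq1 | rfl | hq1
  · simp only [renyiDiv_le_iff_of_lt_one hq1] at hB hC ⊢
    calc EReal.exp ((B + C : ℝ) : EReal) ^ (q.toReal - 1)
        = EReal.exp C ^ (q.toReal - 1) * EReal.exp B ^ (q.toReal - 1) := exp_coe_add_rpow ..
      _ ≤ EReal.exp C ^ (q.toReal - 1) * hellingerIntegral q.toReal μ ν := by gcongr
      _ ≤ hellingerIntegral q.toReal (μ ⊗ₘ κ) (ν ⊗ₘ η) :=
          mul_le_hellingerIntegral_compProd (ENNReal.toReal_pos hq.ne' hq1.ne_top) hC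
  · have hB0 : 0 ≤ B := nonneg_of_renyiDiv_one_le hB
    obtain ⟨a, ha⟩ := hC.exists
    have hC0 : 0 ≤ C := nonneg_of_renyiDiv_one_le ha
    have hac := hC.mono fun a ↦ absolutelyContinuous_of_renyiDiv_le_coe le_rfl
    simp only [renyiDiv_one_le_iff hB0, renyiDiv_one_le_iff hC0] at hB hC
    rw [renyiDiv_one_le_iff (by positivity), klDiv_compProd_eq_add,
      klDiv_compProd_right_eq_lintegral hac, ENNReal.ofReal_add hB0 hC0]
    gcongr
    simpa using lintegral_mono_ae hC
  · rcases eq_or_ne q ∞ with rfl | htop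
    · simp only [renyiDiv_top_le_iff] at hB hC ⊢
      rw [EReal.coe_add, EReal.exp_add, mul_comm]
      exact compProd_le_smul_compProd hB hC
    · simp only [renyiDiv_le_iff_of_one_lt hq1 htop] at hB hC ⊢
      refine ⟨hB.1.compProd (hC.mono fun _ ↦ And.left), ?_⟩
      calc hellingerIntegral q.toReal (μ ⊗ₘ κ) (ν ⊗ₘ η)
          ≤ EReal.exp C ^ (q.toReal - 1) * hellingerIntegral q.toReal μ ν :=
            hellingerIntegral_compProd_le (ENNReal.toReal_pos hq.ne' htop)
              (hC.mono fun _ ↦ And.right)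
        _ ≤ EReal.exp C ^ (q.toReal - 1) * EReal.exp B ^ (q.toReal - 1) := by
            gcongr
            exact hB.2
        _ = EReal.exp ((B + C : ℝ) : EReal) ^ (q.toReal - 1) := (exp_coe_add_rpow ..).symm

lemma snd_compProd_comap {α β γ : Type*} [MeasurableSpace α] [MeasurableSpace β]
    [MeasurableSpace γ] (μ : Measure α) [SFinite μ] (κ : Kernel β γ) [IsSFiniteKernel κ]
    {f : α → β} (hf : Measurable f) : (μ ⊗ₘ κ.comap f hf).snd = (μ.map f).bind κ := by
  rw [Measure.snd_compProd, ← Kernel.comp_deterministic_eq_comap, ← Measure.comp_assoc,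
    Measure.deterministic_comp_eq_map]

/-- The shifted composition rule, with `γ.fst` as the proxy for the starting law `γ.snd`. -/
theorem renyiDiv_bind_le {E F G : Type*} [MeasurableSpace E] [MeasurableSpace F]
    [MeasurableSpace.CountablyGenerated F] [MeasurableSpace G] [StandardBorelSpace G]
    {q : ℝ≥0∞} (hq : 0 < q) {P : Kernel G F} [IsMarkovKernel P] {Q : Kernel E F}
    [IsMarkovKernel Q] {γ : Measure (E × G)} [IsProbabilityMeasure γ] {ν : Measure E}
    [IsFiniteMeasure ν] {B C : ℝ} (hB : renyiDiv q γ.fst ν ≤ (B : EReal))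
    (hC : ∀ᵐ p ∂γ, renyiDiv q (P p.2) (Q p.1) ≤ (C : EReal)) :
    renyiDiv q (γ.snd.bind P) (ν.bind Q) ≤ ((B + C : ℝ) : EReal) := by
  have : Nonempty G := nonempty_of_isProbabilityMeasure γ.snd
  set ρ : Measure (E × G) := ν ⊗ₘ γ.condKernel with hρ
  have hγρ : renyiDiv q γ ρ ≤ (B : EReal) := by
    have h := renyiDiv_compProd_le (κ := γ.condKernel) (η := γ.condKernel) hq hB
      (ae_of_all _ fun a ↦ (renyiDiv_self q _).le)
    rwa [γ.disintegrate γ.condKernel, add_zero] at h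
  have hjoint := renyiDiv_compProd_le (κ := P.comap Prod.snd measurable_snd)
    (η := Q.comap Prod.fst measurable_fst) hq hγρ hC
  have hsnd := (renyiDiv_map_le q measurable_snd).trans hjoint
  have hρ_fst : ρ.fst = ν := by rw [hρ, Measure.fst_compProd]
  rwa [← Measure.snd, ← Measure.snd, snd_compProd_comap, snd_compProd_comap, ← Measure.snd,
    ← Measure.fst, hρ_fst] at hsnd

section Wasserstein

variable {α : Type*} [MeasurableSpace α] {μ ν : Measure α}

lemma isProbabilityMeasure_of_mem_couplings [IsProbabilityMeasure μ] {γ : Measure (α × α)}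
    (hγ : γ ∈ couplings μ ν) : IsProbabilityMeasure γ :=
  ⟨by rw [← Measure.fst_univ, hγ.1, measure_univ]⟩

lemma map_prodMk_mem_couplings {Ω : Type*} [MeasurableSpace Ω] (π : Measure Ω) {f g : Ω → α}
    (hf : Measurable f) (hg : Measurable g) :
    π.map (fun ω ↦ (f ω, g ω)) ∈ couplings (π.map f) (π.map g) :=
  ⟨Measure.fst_map_prodMk hg, Measure.snd_map_prodMk hf⟩

section PseudoEMetric

variable [PseudoEMetricSpace α]

lemma wassersteinInfty_le_of_mem_couplings {γ : Measure (α × α)} (hγ : γ ∈ couplings μ ν)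
    {w : ℝ≥0∞} (h : ∀ᵐ p ∂γ, edist p.1 p.2 ≤ w) : wassersteinInfty μ ν ≤ w :=
  (iInf₂_le γ hγ).trans (essSup_le_of_ae_le _ h)

lemma wassersteinInfty_dirac_le [MeasurableSingletonClass α] (x y : α) :
    wassersteinInfty (Measure.dirac x) (Measure.dirac y) ≤ edist x y := by
  refine wassersteinInfty_le_of_mem_couplings (γ := Measure.dirac (x, y)) ⟨?_, ?_⟩ (by simp)
  · exact Measure.map_dirac' measurable_fst _
  · exact Measure.map_dirac' measurable_snd _

end PseudoEMetric

lemma exists_mem_couplings_dist_le [PseudoMetricSpace α] {w : ℝ}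
    (h : wassersteinInfty μ ν < ENNReal.ofReal w) :
    ∃ γ ∈ couplings μ ν, ∃ w' < w, ∀ᵐ p ∂γ, dist p.1 p.2 ≤ w' := by
  simp only [wassersteinInfty, iInf_lt_iff] at h
  obtain ⟨γ, hγ, hw⟩ := h
  obtain ⟨w', hw'0, hγw', hw'w⟩ := ENNReal.lt_iff_exists_real_btwn.1 hw
  refine ⟨γ, hγ, w', (ENNReal.ofReal_lt_ofReal_iff_of_nonneg hw'0).1 hw'w, ?_⟩
  filter_upwards [ENNReal.ae_le_essSup (μ := γ) fun p : α × α ↦ edist p.1 p.2] with p hp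
  rw [← ENNReal.ofReal_le_ofReal_iff hw'0, ← edist_dist]
  exact hp.trans hγw'.le

lemma exists_interpolation_of_wassersteinInfty_lt {E : Type*} [NormedAddCommGroup E]
    [NormedSpace ℝ E] [MeasurableSpace E] [BorelSpace E] [SecondCountableTopology E]
    {μ' μ : Measure E} [IsProbabilityMeasure μ'] {w t : ℝ}
    (hw : wassersteinInfty μ' μ < ENNReal.ofReal w) (ht0 : 0 ≤ t) (ht1 : t < 1) :
    ∃ μ'' : Measure E, IsProbabilityMeasure μ'' ∧
      (∃ γ ∈ couplings μ' μ'', ∀ᵐ p ∂γ, dist p.1 p.2 ≤ t * w) ∧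
      wassersteinInfty μ'' μ < ENNReal.ofReal ((1 - t) * w) := by
  obtain ⟨π, hπ, w', hw', hdist⟩ := exists_mem_couplings_dist_le hw
  have := isProbabilityMeasure_of_mem_couplings hπ
  have hw0 : 0 < w := ENNReal.ofReal_pos.1 (bot_le.trans_lt hw)
  have ht1' : 0 < 1 - t := sub_pos.2 ht1
  let z : E × E → E := fun p ↦ AffineMap.lineMap p.1 p.2 t
  have hz : Measurable z := by fun_prop
  have hγ := map_prodMk_mem_couplings π measurable_fst hz
  have hγ' := map_prodMk_mem_couplings π hz measurable_snd
  rw [show π.map Prod.fst = μ' from hπ.1] at hγ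
  rw [show π.map Prod.snd = μ from hπ.2] at hγ'
  refine ⟨π.map z, Measure.isProbabilityMeasure_map hz.aemeasurable, ⟨_, hγ, ?_⟩, ?_⟩
  · rw [ae_map_iff (by fun_prop) (measurableSet_le (by fun_prop) (by fun_prop))]
    filter_upwards [hdist] with p hp
    rw [dist_left_lineMap, Real.norm_of_nonneg ht0]
    exact mul_le_mul_of_nonneg_left (hp.trans hw'.le) ht0
  · suffices wassersteinInfty (π.map z) μ ≤ ENNReal.ofReal ((1 - t) * w') from
      this.trans_lt <| (ENNReal.ofReal_lt_ofReal_iff (by positivity)).2 (by gcongr)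
    refine wassersteinInfty_le_of_mem_couplings hγ' ?_
    rw [ae_map_iff (by fun_prop) (measurableSet_le (by fun_prop) (by fun_prop))]
    filter_upwards [hdist] with p hp
    rw [edist_dist, dist_lineMap_right, Real.norm_of_nonneg ht1'.le]
    gcongr

end Wasserstein

section MultiStepFactor

variable {L : ℝ} {n : ℕ}

lemma multiStepFactor_eq_inv_geom_sum (hL : 0 < L) (N : ℕ) :
    multiStepFactor L N = (∑ k ∈ Finset.range N, ((L ^ 2)⁻¹) ^ k)⁻¹ := by
  unfold multiStepFactor
  split_ifs with h
  · simp [h]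
  · have h1 : (L ^ 2)⁻¹ ≠ 1 := by
      simpa [pow_eq_one_iff_of_nonneg hL.le] using h
    rw [geom_sum_eq h1, inv_div, zpow_mul]
    simp [zpow_neg]

lemma multiStepFactor_one (hL : 0 < L) : multiStepFactor L 1 = 1 := by
  simp [multiStepFactor_eq_inv_geom_sum hL]

lemma multiStepFactor_pos (hL : 0 < L) (hn : 1 ≤ n) : 0 < multiStepFactor L n := by
  rw [multiStepFactor_eq_inv_geom_sum hL, inv_pos]
  exact Finset.sum_pos (fun _ _ ↦ by positivity) (Finset.nonempty_range_iff.2 (by omega))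

lemma multiStepFactor_succ (hL : 0 < L) (hn : 1 ≤ n) :
    multiStepFactor L (n + 1) =
      L ^ 2 * multiStepFactor L n / (1 + L ^ 2 * multiStepFactor L n) := by
  have hpos := multiStepFactor_pos hL hn
  rw [multiStepFactor_eq_inv_geom_sum hL, inv_pos] at hpos
  rw [multiStepFactor_eq_inv_geom_sum hL, multiStepFactor_eq_inv_geom_sum hL, geom_sum_succ]
  generalize ∑ k ∈ Finset.range n, ((L ^ 2)⁻¹) ^ k = S at hpos
  field_simp

lemma multiStepFactor_succ_lt_one (hL : 0 < L) (hn : 1 ≤ n) : multiStepFactor L (n + 1) < 1 := by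
  have hpos := multiStepFactor_pos hL hn
  rw [multiStepFactor_succ hL hn, div_lt_one (by positivity)]
  linarith

/-- `t = multiStepFactor L (n + 1)` is the minimizer of
`t ^ 2 + multiStepFactor L n * (L * (1 - t)) ^ 2`, and the minimum is `t` itself. -/
lemma sq_multiStepFactor_add (hL : 0 < L) (hn : 1 ≤ n) :
    multiStepFactor L (n + 1) ^ 2 +
      multiStepFactor L n * (L * (1 - multiStepFactor L (n + 1))) ^ 2 =
        multiStepFactor L (n + 1) := by
  have hpos := multiStepFactor_pos hL hn
  rw [multiStepFactor_succ hL hn]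
  field_simp
  ring

end MultiStepFactor

lemma bind_bind_pow {E : Type*} [MeasurableSpace E] (P : Kernel E E) (n : ℕ) (μ : Measure E) :
    (μ.bind P).bind (P ^ n : Kernel E E) = μ.bind (P ^ (n + 1) : Kernel E E) := by
  rw [Measure.comp_assoc, pow_succ]
  rfl

lemma renyiDiv_bind_le_of_mem_couplings {E : Type*} [PseudoMetricSpace E] [MeasurableSpace E]
    [StandardBorelSpace E] {q : ℝ≥0∞} (hq : 0 < q) {P : Kernel E E} [IsMarkovKernel P] {c : ℝ}
    (hc : 0 ≤ c) (h_reg : ∀ x y, renyiDiv q (P x) (P y) ≤ ((c * dist x y ^ 2 : ℝ) : EReal))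
    {μ' μ ν : Measure E} [IsProbabilityMeasure μ'] [IsFiniteMeasure ν] {γ : Measure (E × E)}
    (hγ : γ ∈ couplings μ' μ) {B r : ℝ} (hB : renyiDiv q μ' ν ≤ (B : EReal))
    (hr : ∀ᵐ p ∂γ, dist p.1 p.2 ≤ r) :
    renyiDiv q (μ.bind P) (ν.bind P) ≤ ((B + c * r ^ 2 : ℝ) : EReal) := by
  have := isProbabilityMeasure_of_mem_couplings hγ
  obtain ⟨rfl, rfl⟩ := hγ
  refine renyiDiv_bind_le hq hB (hr.mono fun p hp ↦ (h_reg _ _).trans ?_)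
  rw [dist_comm, EReal.coe_le_coe_iff]
  gcongr

section MultiStep

variable {E : Type*} [NormedAddCommGroup E] [NormedSpace ℝ E] [MeasurableSpace E] [BorelSpace E]
  [SecondCountableTopology E] [StandardBorelSpace E] {q : ℝ≥0∞} {P : Kernel E E}
  [IsMarkovKernel P] {c L w : ℝ} {N : ℕ}

theorem renyiDiv_bind_pow_le_of_wassersteinInfty_lt (hq : 0 < q) (hc : 0 ≤ c)
    (h_reg : ∀ x y, renyiDiv q (P x) (P y) ≤ ((c * dist x y ^ 2 : ℝ) : EReal)) (hL : 0 < L)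
    (h_lip : ∀ μ ν : Measure E, IsProbabilityMeasure μ → IsProbabilityMeasure ν →
      wassersteinInfty (μ.bind P) (ν.bind P) ≤ ENNReal.ofReal L * wassersteinInfty μ ν)
    (hN : 1 ≤ N) {μ' μ ν : Measure E} [IsProbabilityMeasure μ'] [IsProbabilityMeasure μ]
    [IsFiniteMeasure ν] {B : ℝ} (hB : renyiDiv q μ' ν ≤ (B : EReal))
    (hw : wassersteinInfty μ' μ < ENNReal.ofReal w) :
    renyiDiv q (μ.bind (P ^ N : Kernel E E)) (ν.bind (P ^ N : Kernel E E)) ≤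
      ((B + c * multiStepFactor L N * w ^ 2 : ℝ) : EReal) := by
  induction N, hN using Nat.le_induction generalizing μ' μ ν B w with
  | base =>
    obtain ⟨γ, hγ, w', hw', hdist⟩ := exists_mem_couplings_dist_le hw
    rw [pow_one, multiStepFactor_one hL, mul_one]
    exact renyiDiv_bind_le_of_mem_couplings hq hc h_reg hγ hB
      (hdist.mono fun _ hp ↦ hp.trans hw'.le)
  | succ n hn ih =>
    set t := multiStepFactor L (n + 1)
    have ht0 : 0 ≤ t := (multiStepFactor_pos hL n.succ_pos).le
    have ht1 : t < 1 := multiStepFactor_succ_lt_one hL hn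
    have hsplit : t ^ 2 + multiStepFactor L n * (L * (1 - t)) ^ 2 = t :=
      sq_multiStepFactor_add hL hn
    obtain ⟨μ'', hμ'', ⟨γ, hγ, hdist⟩, hW⟩ :=
      exists_interpolation_of_wassersteinInfty_lt hw ht0 ht1
    have hstep : renyiDiv q (μ''.bind P) (ν.bind P) ≤ ((B + c * (t * w) ^ 2 : ℝ) : EReal) :=
      renyiDiv_bind_le_of_mem_couplings hq hc h_reg hγ hB hdist
    have hW_bind : wassersteinInfty (μ''.bind P) (μ.bind P) <
        ENNReal.ofReal (L * ((1 - t) * w)) := by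
      rw [ENNReal.ofReal_mul hL.le]
      exact (h_lip _ _ inferInstance inferInstance).trans_lt
        (ENNReal.mul_lt_mul_right (by simpa) ENNReal.ofReal_ne_top hW)
    rw [← bind_bind_pow, ← bind_bind_pow]
    refine (ih hstep hW_bind).trans_eq ?_
    congr 1
    linear_combination c * w ^ 2 * hsplit

theorem renyiDiv_bind_pow_le (hq : 0 < q) (hc : 0 ≤ c)
    (h_reg : ∀ x y, renyiDiv q (P x) (P y) ≤ ((c * dist x y ^ 2 : ℝ) : EReal)) (hL : 0 < L)
    (h_lip : ∀ μ ν : Measure E, IsProbabilityMeasure μ → IsProbabilityMeasure ν →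
      wassersteinInfty (μ.bind P) (ν.bind P) ≤ ENNReal.ofReal L * wassersteinInfty μ ν)
    (hN : 1 ≤ N) {μ ν : Measure E} [IsProbabilityMeasure μ] [IsProbabilityMeasure ν]
    (hw0 : 0 ≤ w) (hw : wassersteinInfty ν μ ≤ ENNReal.ofReal w) :
    renyiDiv q (μ.bind (P ^ N : Kernel E E)) (ν.bind (P ^ N : Kernel E E)) ≤
      ((c * multiStepFactor L N * w ^ 2 : ℝ) : EReal) := by
  have hbound : ∀ w' ∈ Set.Ioi w,
      renyiDiv q (μ.bind (P ^ N : Kernel E E)) (ν.bind (P ^ N : Kernel E E)) ≤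
        ((c * multiStepFactor L N * w' ^ 2 : ℝ) : EReal) := fun w' hw' ↦ by
    have hlt := hw.trans_lt ((ENNReal.ofReal_lt_ofReal_iff (hw0.trans_lt hw')).2 hw')
    simpa using renyiDiv_bind_pow_le_of_wassersteinInfty_lt hq hc h_reg hL h_lip hN
      (renyiDiv_self q ν).le hlt
  have hcont : Continuous fun w' : ℝ ↦ ((c * multiStepFactor L N * w' ^ 2 : ℝ) : EReal) :=
    continuous_coe_real_ereal.comp (by fun_prop)
  exact ge_of_tendsto (hcont.tendsto w |>.mono_left nhdsWithin_le_nhds)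
    (Filter.eventually_of_mem self_mem_nhdsWithin hbound)

theorem theorem3p2_general (hq : 0 < q) (hc : 0 ≤ c)
    (h_reg : ∀ x y, renyiDiv q (P x) (P y) ≤ ((c * ‖x - y‖ ^ 2 : ℝ) : EReal)) (hL : 0 < L)
    (h_lip : ∀ μ ν : Measure E, IsProbabilityMeasure μ → IsProbabilityMeasure ν →
      wassersteinInfty (μ.bind P) (ν.bind P) ≤ ENNReal.ofReal L * wassersteinInfty μ ν)
    (hN : 1 ≤ N) (x y : E) :
    renyiDiv q ((P ^ N) x) ((P ^ N) y) ≤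
      ((c * multiStepFactor L N * ‖x - y‖ ^ 2 : ℝ) : EReal) := by
  have hw : wassersteinInfty (Measure.dirac y) (Measure.dirac x) ≤ ENNReal.ofReal ‖x - y‖ := by
    rw [← dist_eq_norm, dist_comm, ← edist_dist]
    exact wassersteinInfty_dirac_le y x
  have h := renyiDiv_bind_pow_le hq hc (by simpa only [dist_eq_norm] using h_reg) hL h_lip hN
    (norm_nonneg (x - y)) hw
  rwa [Measure.dirac_bind (Kernel.measurable _), Measure.dirac_bind (Kernel.measurable _)] at h

end MultiStep

theorem theorem3p2 (d : ℕ) (q : ℝ≥0∞) (hq : 0 < q)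
    (P : Kernel (EuclideanSpace ℝ (Fin d)) (EuclideanSpace ℝ (Fin d))) [IsMarkovKernel P]
    (c : ℝ) (hc : 0 < c)
    (h_reg : ∀ x y : EuclideanSpace ℝ (Fin d),
      renyiDiv q (P x) (P y) ≤ ((c * ‖x - y‖ ^ 2 : ℝ) : EReal))
    (h_reg_one : q < 1 → ∃ c' : ℝ, ∀ x y : EuclideanSpace ℝ (Fin d),
      renyiDiv 1 (P x) (P y) ≤ ((c' * ‖x - y‖ ^ 2 : ℝ) : EReal))
    (L : ℝ) (hL : 0 < L)
    (h_lip : ∀ μ ν : Measure (EuclideanSpace ℝ (Fin d)),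
      IsProbabilityMeasure μ → IsProbabilityMeasure ν →
      wassersteinInfty (μ.bind P) (ν.bind P) ≤ ENNReal.ofReal L * wassersteinInfty μ ν)
    (N : ℕ) (hN : 1 ≤ N) (x y : EuclideanSpace ℝ (Fin d)) :
    renyiDiv q ((P ^ N) x) ((P ^ N) y) ≤
      ((c * multiStepFactor L N * ‖x - y‖ ^ 2 : ℝ) : EReal) :=
  theorem3p2_general hq hc.le h_reg hL h_lip hN x y
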